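/- Let $S$ be a finite set and let $p(x,y)$, $x,y\in S$, be the transition probabilities of an irreducible Markov chain on $S$ that is symmetric, i.e. $p(x,y)=p(y,x)$. The symmetric exclusion process with parameters $p$ is the Markov process $(\eta_t)_{t\ge 0}$ on $\{0,1\}^S$ with generator $$\mathcal L f(\eta)=\sum_{x,y\in S:\ \eta(x)=1,\ \eta(y)=0}p(x,y)\,[f(\eta_{x,y})-f(\eta)],$$ where $\eta_{x,y}$ is the configuration obtained from $\eta$ by interchanging the coordinates $\eta(x)$ and $\eta(y)$; that is, $E[f(\eta_{s+t})\mid \eta_u,\,u\le s]=(e^{t\mathcal L}f)(\eta_s)$ almost surely for all $s,t\ge 0$ and all $f:\{0,1\}^S\to\mathbb R$. The generating polynomial of a probability measure $\mu$ on $\{0,1\}^S$ is $$Q_\mu(z)=\sum_{\eta\in\{0,1\}^S}\mu(\{\eta\})\prod_{x\in S}z_x^{\eta(x)},\qquad z\in\mathbb C^S,$$ and a complex polynomial $Q$ in the variables $(z_x)_{x\in S}$ is called stable if $Q(z)\ne 0$ whenever $\operatorname{Im}(z_x)>0$ for every $x\in S$. Corollary 5.3. If the generating polynomial of the distribution of $\eta_0$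 is stable, then for every $t>0$ the generating polynomial of the distribution of $\eta_t$ is stable. -/

import Mathlib

open MeasureTheory ProbabilityTheory
open scoped NNReal

noncomputable section

/-- Configurations `η ∈ {0,1}^S`; `true` (occupied) stands for `1`, `false` (empty) for `0`.
It carries the product σ-algebra, which for finite `S` contains every set of configurations. -/
abbrev Config (S : Type*) := S → Bool

/-- `p(x,y)` are the transition probabilities of a symmetric, irreducible Markov chain on the
finite set `S`. -/
structure IsSymmetricIrreducibleChain {S : Type*} [Fintype S] [DecidableEq S]
    (p : Matrix S S ℝ) : Prop where
  stochastic : p ∈ Matrix.rowStochastic ℝ S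
  symmetric : p.IsSymm
  irreducible : p.IsIrreducible

/-- `η_{x,y}`: the configuration `η` with the coordinates `η(x)` and `η(y)` interchanged. -/
def interchange {S : Type*} [DecidableEq S] (x y : S) (η : Config S) : Config S :=
  fun z => η (Equiv.swap x y z)

/-- The generator of the exclusion process,
`(𝓛 f)(η) = ∑_{η(x) = 1, η(y) = 0} p(x,y) (f(η_{x,y}) - f(η))`,
a (bounded) linear operator on the finite-dimensional space of functions on `{0,1}^S`. -/
def exclusionGenerator {S : Type*} [Fintype S] [DecidableEq S] (p : Matrix S S ℝ) :
    (Config S → ℝ) →L[ℝ] (Config S → ℝ) :=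
  LinearMap.toContinuousLinearMap
    { toFun := fun f η => ∑ x : S, ∑ y : S,
        if η x = true ∧ η y = false then p x y * (f (interchange x y η) - f η) else 0
      map_add' := by
        intro f g
        funext η
        simp only [Pi.add_apply, ← Finset.sum_add_distrib]
        refine Finset.sum_congr rfl fun x _ => Finset.sum_congr rfl fun y _ => ?_
        split_ifs <;> ring
      map_smul' := by
        intro c f
        funext η
        simp only [Pi.smul_apply, smul_eq_mul, Finset.mul_sum, RingHom.id_apply]
        refine Finset.sum_congr rfl fun x _ => Finset.sum_congr rfl fun y _ => ?_
        split_ifs <;> ring }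

/-- The Markov semigroup `exp(t 𝓛)` of the exclusion process. -/
def exclusionSemigroup {S : Type*} [Fintype S] [DecidableEq S] (p : Matrix S S ℝ) (t : ℝ≥0) :
    (Config S → ℝ) →L[ℝ] (Config S → ℝ) :=
  NormedSpace.exp ((t : ℝ) • exclusionGenerator p)

/-- `η = (η_t)_{t ≥ 0}` is, under `P`, an exclusion process with jump probabilities `p` (and an
arbitrary initial distribution): a Markov process with respect to its own filtration
`𝓕_s = σ(η_u : u ≤ s)`, whose transition semigroup is the one generated by `𝓛`, that is,
`E[f(η_{s+t}) | 𝓕_s] = (exp(t 𝓛) f)(η_s)` almost surely. Regularity of the paths does not affect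
the distributions at fixed times and is not required. -/
structure IsExclusionProcess {S : Type*} [Fintype S] [DecidableEq S] (p : Matrix S S ℝ)
    {Ω : Type*} [MeasurableSpace Ω] (P : Measure Ω) (η : ℝ≥0 → Ω → Config S) : Prop where
  measurable : ∀ t, Measurable (η t)
  markov : ∀ (s t : ℝ≥0) (f : Config S → ℝ),
    P[fun ω => f (η (s + t) ω) | ⨆ u ∈ Set.Iic s, MeasurableSpace.comap (η u) inferInstance]
      =ᵐ[P] fun ω => exclusionSemigroup p t f (η s ω)

/-- The generating polynomial `Q(z) = E^μ ∏_{x ∈ S} z_x^{η(x)}` of a probability measure `μ` on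
`{0,1}^S`, as a polynomial with complex coefficients in the variables `z_x`, `x ∈ S`. -/
def generatingPolynomial {S : Type*} [Fintype S] [DecidableEq S] (μ : Measure (Config S)) :
    MvPolynomial S ℂ :=
  ∑ η : Config S, MvPolynomial.C (μ.real {η} : ℂ) *
    ∏ x : S, MvPolynomial.X x ^ (if η x = true then 1 else 0)

/-- A complex polynomial is stable if it has no zero all of whose coordinates have (strictly)
positive imaginary part. -/
def IsStablePolynomial {S : Type*} (Q : MvPolynomial S ℂ) : Prop :=
  ∀ z : S → ℂ, (∀ x, 0 < (z x).im) → MvPolynomial.eval z Q ≠ 0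

end

/-! By symmetry of `p`, the generator is a sum over pairs of (p(x,y)/2)(T − 1), with T the
interchange of two coordinates (`exclusionGenerator_eq`). Chernoff's formula
(`tendsto_pow_exp_of_hasDerivAt`) makes the semigroup a limit of products of factors 1 + α(T − 1)
with α in [0,1]. Each factor preserves stability (`IsStableFunctional.comp_partial_symmetrization`):
with the other variables fixed, this reduces to convexity of a quadratic condition on affine
functions. In the limit a Harnack-type bound replaces Hurwitz's theorem: a zero at one point of the
half-planes would force zeros at all of them, and by continuity at (1, …, 1), where the total mass
is 1. Positivity of the measures plays no role in preserving stability, so the argument runs on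
linear functionals. -/

/-! ### Chernoff's product formula -/

open Filter Topology in
theorem norm_pow_sub_pow_le_of_norm_le {A : Type*} [NormedRing A] [NormOneClass A] {X Y : A} {M : ℝ}
    (hM : 1 ≤ M) (hX : ‖X‖ ≤ M) (hY : ‖Y‖ ≤ M) (n : ℕ) :
    ‖X ^ n - Y ^ n‖ ≤ n * ‖X - Y‖ * M ^ n := by
  induction n with
  | zero => simp
  | succ n ih =>
    have h : X ^ (n + 1) - Y ^ (n + 1) = X * (X ^ n - Y ^ n) + (X - Y) * Y ^ n := by
      rw [pow_succ', pow_succ']; noncomm_ring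
    have hYn : ‖Y ^ n‖ ≤ M ^ n := (norm_pow_le Y n).trans (by gcongr)
    have hMn : M ^ n ≤ M ^ (n + 1) := pow_le_pow_right₀ hM (Nat.le_succ n)
    calc ‖X ^ (n + 1) - Y ^ (n + 1)‖ ≤ ‖X‖ * ‖X ^ n - Y ^ n‖ + ‖X - Y‖ * ‖Y ^ n‖ := by
          rw [h]
          exact (norm_add_le _ _).trans (add_le_add (norm_mul_le _ _) (norm_mul_le _ _))
      _ ≤ M * (n * ‖X - Y‖ * M ^ n) + ‖X - Y‖ * M ^ (n + 1) := by
          gcongr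
          exact hYn.trans hMn
      _ = (n + 1 : ℕ) * ‖X - Y‖ * M ^ (n + 1) := by push_cast; ring

open Filter Topology in
theorem eventually_norm_le_one_add_of_hasDerivAt {A : Type*} [NormedRing A] [NormOneClass A]
    [NormedAlgebra ℝ A] {F : ℝ → A} {L : A} (h0 : F 0 = 1) (hF : HasDerivAt F L 0) :
    ∀ᶠ s in 𝓝 (0 : ℝ), ‖F s‖ ≤ 1 + (‖L‖ + 1) * |s| := by
  have h := (hasDerivAt_iff_isLittleO.1 hF).def one_pos
  filter_upwards [h] with s hs
  simp only [sub_zero, h0, one_mul, Real.norm_eq_abs] at hs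
  calc ‖F s‖ = ‖(F s - 1 - s • L) + 1 + s • L‖ := by congr 1; abel
    _ ≤ ‖F s - 1 - s • L‖ + ‖(1 : A)‖ + ‖s • L‖ := norm_add₃_le
    _ ≤ |s| + 1 + |s| * ‖L‖ := by
        rw [norm_one, norm_smul, Real.norm_eq_abs]; gcongr
    _ = _ := by ring

open Filter Topology in
/-- Chernoff's product formula in a Banach algebra. -/
theorem tendsto_pow_exp_of_hasDerivAt {A : Type*} [NormedRing A] [NormOneClass A]
    [NormedAlgebra ℝ A] [CompleteSpace A] {F : ℝ → A} {L : A} (h0 : F 0 = 1)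
    (hF : HasDerivAt F L 0) (t : ℝ) :
    Tendsto (fun n : ℕ => F (t / n) ^ n) atTop (𝓝 (NormedSpace.exp (t • L))) := by
  set E : ℝ → A := fun s => NormedSpace.exp (s • L) with hE
  have hE0 : E 0 = 1 := by simp [hE]
  have hE' : HasDerivAt E L 0 := by
    simpa using hasDerivAt_exp_smul_const (𝕂 := ℝ) L (0 : ℝ)
  have hlim : Tendsto (fun n : ℕ => t / (n : ℝ)) atTop (𝓝 0) :=
    tendsto_const_div_atTop_nhds_zero_nat t
  set C : ℝ := (‖L‖ + 1) * |t|
  have hC : 0 ≤ C := by positivity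
  rw [tendsto_iff_norm_sub_tendsto_zero, Metric.tendsto_atTop]
  intro ε hε
  obtain ⟨δ, hδ, hδε⟩ : ∃ δ > 0, δ * (|t| * Real.exp C) < ε := by
    -- Telescoping n factors will cost δ|t|e^C in total; the added 1 covers t = 0.
    refine ⟨ε / (|t| * Real.exp C + 1), by positivity, ?_⟩
    rw [div_mul_eq_mul_div, div_lt_iff₀ (by positivity)]
    nlinarith
  have hd : ∀ᶠ s in 𝓝 (0 : ℝ), ‖F s - E s‖ ≤ δ * |s| := by
    have h := (hasDerivAt_iff_isLittleO.1 (hF.sub hE')).def hδ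
    filter_upwards [h] with s hs
    simpa [h0, hE0] using hs
  have h := hlim.eventually (hd.and ((eventually_norm_le_one_add_of_hasDerivAt h0 hF).and
    (eventually_norm_le_one_add_of_hasDerivAt hE0 hE')))
  obtain ⟨N, hN⟩ := eventually_atTop.1 (h.and (eventually_ge_atTop 1))
  refine ⟨N, fun n hn => ?_⟩
  obtain ⟨⟨h1, h2, h3⟩, hn1⟩ := hN n hn
  have hn0 : (0 : ℝ) < n := by exact_mod_cast hn1
  have hEn : NormedSpace.exp (t • L) = E (t / n) ^ n := by
    let _ : NormedAlgebra ℚ A := NormedAlgebra.restrictScalars ℚ ℝ A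
    rw [hE]
    simp only
    rw [← NormedSpace.exp_nsmul, ← Nat.cast_smul_eq_nsmul ℝ, smul_smul, mul_div_cancel₀ _ hn0.ne']
  have habs : |t / (n : ℝ)| = |t| / n := by rw [abs_div, abs_of_pos hn0]
  have hM : (‖L‖ + 1) * |t / (n : ℝ)| = C / n := by rw [habs, mul_div_assoc]
  rw [hM] at h2 h3
  have hpow : (1 + C / n) ^ n ≤ Real.exp C := by
    calc (1 + C / n) ^ n ≤ (Real.exp (C / n)) ^ n := by
          gcongr
          rw [add_comm]; exact Real.add_one_le_exp _
      _ = Real.exp C := by rw [← Real.exp_nat_mul, mul_div_cancel₀ _ hn0.ne']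
  rw [Real.dist_eq, sub_zero, abs_norm, hEn]
  calc _ ≤ n * ‖F (t / n) - E (t / n)‖ * (1 + C / n) ^ n :=
        norm_pow_sub_pow_le_of_norm_le (le_add_of_nonneg_right (by positivity)) h2 h3 n
    _ ≤ n * (δ * |t / n|) * Real.exp C := by gcongr
    _ = δ * (|t| * Real.exp C) := by rw [habs]; field_simp
    _ < ε := hδε

/-- At s = 0 all factors equal 1, so the product rule gives the plain sum although the factors need
not commute. -/
theorem hasDerivAt_list_prod_one_add_smul {A ι : Type*} [NormedRing A] [NormedAlgebra ℝ A]
    (B : ι → A) (l : List ι) :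
    HasDerivAt (fun s : ℝ => (l.map fun i => 1 + s • B i).prod) (l.map B).sum 0 := by
  induction l with
  | nil => simpa using hasDerivAt_const (0 : ℝ) (1 : A)
  | cons i l ih =>
    have h : HasDerivAt (fun s : ℝ => 1 + s • B i) (B i) 0 := by
      simpa using ((hasDerivAt_id (0 : ℝ)).smul_const (B i)).const_add 1
    have h1 : (l.map fun _ => (1 : A)).prod = 1 := by simp
    simpa [h1, Pi.mul_def] using h.mul ih

/-! ### Affine functions on the upper half-plane -/

/-- An affine function without zeros in the upper half-plane. -/
theorem affine_ne_zero_iff {c d ζ : ℂ} (hc : c ≠ 0) :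
    (∀ u : ℂ, 0 < u.im → c * (1 + d * (u - ζ)) ≠ 0) ↔ ζ.im * Complex.normSq d + d.im ≤ 0 := by
  constructor
  · intro h
    by_contra! hlt
    have hd : d ≠ 0 := by rintro rfl; simp at hlt
    have hd' : 0 < Complex.normSq d := Complex.normSq_pos.2 hd
    -- This is the only zero; its imaginary part is the left side of the criterion divided by |d|².
    refine h (ζ - d⁻¹) ?_ ?_
    · rw [Complex.sub_im, Complex.inv_im, neg_div, sub_neg_eq_add]
      have : ζ.im + d.im / Complex.normSq d
          = (ζ.im * Complex.normSq d + d.im) / Complex.normSq d := by field_simp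
      rw [this]; positivity
    · field_simp; ring
  · intro h u hu h0
    have h1 : d * (u - ζ) = -1 := by
      have := (mul_eq_zero.1 h0).resolve_left hc
      linear_combination this
    have hre := congrArg Complex.re h1
    have him := congrArg Complex.im h1
    simp only [Complex.mul_re, Complex.mul_im, Complex.sub_re, Complex.sub_im, Complex.neg_re,
      Complex.neg_im, Complex.one_re, Complex.one_im] at hre him
    rw [Complex.normSq_apply] at h
    have hd : 0 < d.re * d.re + d.im * d.im := by
      rw [← Complex.normSq_apply]
      refine Complex.normSq_pos.2 ?_
      rintro rfl
      simp at hre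
    have key : (d.re * d.re + d.im * d.im) * (u.im - ζ.im) = d.im := by
      linear_combination d.re * him - d.im * hre
    nlinarith [mul_pos hd hu]

theorem affine_rewrite {a b ζ : ℂ} (h : a + b * ζ ≠ 0) (u : ℂ) :
    a + b * u = (a + b * ζ) * (1 + b / (a + b * ζ) * (u - ζ)) := by
  field_simp; ring

theorem affine_im_le {a b ζ : ℂ} (hζ : 0 < ζ.im) (h : ∀ u : ℂ, 0 < u.im → a + b * u ≠ 0) :
    ζ.im * Complex.normSq (b / (a + b * ζ)) + (b / (a + b * ζ)).im ≤ 0 :=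
  (affine_ne_zero_iff (h ζ hζ)).1 fun u hu => affine_rewrite (h ζ hζ) u ▸ h u hu

/-- A common value at ζ lets both functions be normalized by the same constant. The combination then
has slope (1 − α)d + αd', and the criterion Im ζ·|d|² + Im d ≤ 0 is convex in d. -/
theorem convex_comb_affine_ne_zero {a b a' b' ζ : ℂ} (hζ : 0 < ζ.im)
    (h : ∀ u : ℂ, 0 < u.im → a + b * u ≠ 0) (h' : ∀ u : ℂ, 0 < u.im → a' + b' * u ≠ 0)
    (heq : a + b * ζ = a' + b' * ζ) {α : ℝ} (h0 : 0 ≤ α) (h1 : α ≤ 1) {u : ℂ} (hu : 0 < u.im) :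
    (1 - α) * (a + b * u) + α * (a' + b' * u) ≠ 0 := by
  have hc := h ζ hζ
  have hc' := h' ζ hζ
  replace h := affine_im_le hζ h
  replace h' := affine_im_le hζ h'
  rw [affine_rewrite hc, affine_rewrite hc', ← heq]
  rw [← heq] at h'
  set c := a + b * ζ
  set d := b / c
  set d' := b' / c
  have hd : ζ.im * Complex.normSq ((1 - α) * d + α * d') + ((1 - α) * d + α * d').im ≤ 0 := by
    have e : (1 - α : ℂ) = ((1 - α : ℝ) : ℂ) := by push_cast; rfl
    rw [e]
    simp only [Complex.normSq_apply, Complex.add_re, Complex.add_im, Complex.re_ofReal_mul,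
      Complex.im_ofReal_mul] at h h' ⊢
    -- The convexity gap is Im ζ·α(1 − α)|d − d'|².
    nlinarith [mul_nonneg (mul_nonneg hζ.le (mul_nonneg h0 (sub_nonneg.2 h1)))
      (add_nonneg (mul_self_nonneg (d.re - d'.re)) (mul_self_nonneg (d.im - d'.im))),
      mul_nonneg h0 (neg_nonneg.2 h'), mul_nonneg (sub_nonneg.2 h1) (neg_nonneg.2 h)]
  have := (affine_ne_zero_iff hc).2 hd u hu
  convert this using 1
  ring

/-- The criterion gives Im ζ·|d|² ≤ −Im d ≤ |d|, hence |d| ≤ 1/Im ζ for the normalized slope d. -/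
theorem norm_affine_le {a b ζ u : ℂ} (hζ : 0 < ζ.im)
    (h : ∀ u : ℂ, 0 < u.im → a + b * u ≠ 0) :
    ‖a + b * u‖ ≤ (1 + ‖u - ζ‖ / ζ.im) * ‖a + b * ζ‖ := by
  have hc := h ζ hζ
  replace h := affine_im_le hζ h
  rw [affine_rewrite hc u, norm_mul, mul_comm]
  set d := b / (a + b * ζ)
  have hd : ‖d‖ ≤ ζ.im⁻¹ := by
    rw [Complex.normSq_eq_norm_sq] at h
    have h2 := (abs_le.1 (Complex.abs_im_le_norm d)).1
    rcases (norm_nonneg d).eq_or_lt with hd | hd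
    · rw [← hd]; positivity
    · rw [← mul_le_mul_iff_right₀ hζ, mul_inv_cancel₀ hζ.ne']
      nlinarith
  gcongr
  refine (norm_add_le _ _).trans ?_
  rw [norm_one, norm_mul, div_eq_inv_mul]
  gcongr

/-! ### Stable functionals, partial symmetrization and limits -/

/-- The generating polynomial, as a function of `z`, of a linear functional on observables. -/
noncomputable def functionalPGF {S : Type*} [Fintype S] [DecidableEq S]
    (ℓ : (Config S → ℝ) →L[ℝ] ℝ) (z : S → ℂ) : ℂ :=
  ∑ η : Config S, (ℓ (Pi.single η 1) : ℂ) * ∏ x : S, if η x = true then z x else 1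

/-- The functional has a generating polynomial without zeros in the product of upper
half-planes. -/
def IsStableFunctional {S : Type*} [Fintype S] [DecidableEq S]
    (ℓ : (Config S → ℝ) →L[ℝ] ℝ) : Prop :=
  ∀ z : S → ℂ, (∀ x, 0 < (z x).im) → functionalPGF ℓ z ≠ 0

/-- The action on observables of interchanging the coordinates `x` and `y`. -/
noncomputable def interchangeCLM {S : Type*} [Fintype S] [DecidableEq S] (x y : S) :
    (Config S → ℝ) →L[ℝ] (Config S → ℝ) :=
  LinearMap.toContinuousLinearMap (LinearMap.funLeft ℝ ℝ (interchange x y))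

theorem interchange_involutive {S : Type*} [DecidableEq S] (x y : S) :
    Function.Involutive (interchange x y) := by
  intro η
  funext z
  simp [interchange]

theorem interchange_comm {S : Type*} [DecidableEq S] (x y : S) :
    interchange x y = interchange y x := by
  funext η z
  simp [interchange, Equiv.swap_comm]

theorem interchange_eq_self {S : Type*} [DecidableEq S] {x y : S} {η : Config S} (h : η x = η y) :
    interchange x y η = η := by
  funext z
  unfold interchange
  rcases eq_or_ne z x with rfl | hx
  · rw [Equiv.swap_apply_left, h]
  rcases eq_or_ne z y with rfl | hy
  · rw [Equiv.swap_apply_right, h]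
  · rw [Equiv.swap_apply_of_ne_of_ne hx hy]

theorem update_im_pos {S : Type*} [DecidableEq S] {z : S → ℂ}
    (hz : ∀ x, 0 < (z x).im) (x : S) {u : ℂ} (hu : 0 < u.im) :
    ∀ w, 0 < (Function.update z x u w).im := by
  intro w
  rcases eq_or_ne w x with rfl | h
  · simpa using hu
  · simpa [h] using hz w

section

variable {S : Type*} [Fintype S] [DecidableEq S]

theorem interchangeCLM_apply (x y : S) (f : Config S → ℝ) (η : Config S) :
    interchangeCLM x y f η = f (interchange x y η) := rfl

theorem interchangeCLM_self (x : S) : interchangeCLM x x = 1 := by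
  ext f η
  simp [interchangeCLM_apply, interchange_eq_self]

theorem interchangeCLM_single (x y : S) (η : Config S) :
    interchangeCLM x y (Pi.single η 1) = Pi.single (interchange x y η) 1 := by
  funext ξ
  rw [interchangeCLM_apply, Pi.single_apply, Pi.single_apply]
  congr 1
  exact propext ⟨fun h => by rw [← h, interchange_involutive],
    fun h => by rw [h, interchange_involutive]⟩

theorem functionalPGF_comp_interchange (ℓ : (Config S → ℝ) →L[ℝ] ℝ) (x y : S) (z : S → ℂ) :
    functionalPGF (ℓ ∘L interchangeCLM x y) z = functionalPGF ℓ (z ∘ Equiv.swap x y) := by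
  unfold functionalPGF
  refine Fintype.sum_equiv (interchange_involutive x y).toPerm _ _ fun η => ?_
  rw [ContinuousLinearMap.comp_apply, interchangeCLM_single]
  congr 1
  refine Fintype.prod_equiv (Equiv.swap x y) _ _ fun w => ?_
  simp [interchange]

theorem functionalPGF_add (ℓ ℓ' : (Config S → ℝ) →L[ℝ] ℝ) (z : S → ℂ) :
    functionalPGF (ℓ + ℓ') z = functionalPGF ℓ z + functionalPGF ℓ' z := by
  simp [functionalPGF, add_mul, Finset.sum_add_distrib]

theorem functionalPGF_smul (c : ℝ) (ℓ : (Config S → ℝ) →L[ℝ] ℝ) (z : S → ℂ) :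
    functionalPGF (c • ℓ) z = c * functionalPGF ℓ z := by
  simp [functionalPGF, Finset.mul_sum, mul_assoc]

theorem continuous_functionalPGF (ℓ : (Config S → ℝ) →L[ℝ] ℝ) :
    Continuous (functionalPGF ℓ) := by
  unfold functionalPGF
  refine continuous_finsetSum _ fun η _ => continuous_const.mul ?_
  refine continuous_finsetProd _ fun x _ => ?_
  split_ifs
  · exact continuous_apply x
  · exact continuous_const

theorem continuous_functionalPGF_comp (ℓ : (Config S → ℝ) →L[ℝ] ℝ) (z : S → ℂ) :
    Continuous fun A : (Config S → ℝ) →L[ℝ] (Config S → ℝ) => functionalPGF (ℓ ∘L A) z := by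
  unfold functionalPGF
  refine continuous_finsetSum _ fun η _ => Continuous.mul ?_ continuous_const
  refine Complex.continuous_ofReal.comp (ℓ.continuous.comp ?_)
  exact (ContinuousLinearMap.apply ℝ (Config S → ℝ) (Pi.single η 1)).continuous

/-- The generating polynomial is affine in each variable. -/
theorem exists_functionalPGF_update_eq (ℓ : (Config S → ℝ) →L[ℝ] ℝ) (z : S → ℂ) (x : S) :
    ∃ a b : ℂ, ∀ u : ℂ, functionalPGF ℓ (Function.update z x u) = a + b * u := by
  let c : Config S → ℂ := fun η =>
    (ℓ (Pi.single η 1) : ℂ) * ∏ w ∈ Finset.univ.erase x, if η w = true then z w else 1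
  refine ⟨∑ η, if η x = true then 0 else c η, ∑ η, if η x = true then c η else 0, fun u => ?_⟩
  rw [Finset.sum_mul, ← Finset.sum_add_distrib]
  refine Finset.sum_congr rfl fun η _ => ?_
  rw [← Finset.mul_prod_erase _ _ (Finset.mem_univ x)]
  have h : (∏ w ∈ Finset.univ.erase x, if η w = true then Function.update z x u w else 1)
      = ∏ w ∈ Finset.univ.erase x, if η w = true then z w else 1 := by
    refine Finset.prod_congr rfl fun w hw => ?_
    rw [Function.update_of_ne (Finset.ne_of_mem_erase hw)]
  rw [h, Function.update_self]
  split_ifs <;> simp only [c] <;> ring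

/-- Stability is preserved by a partial symmetrization in two coordinates. -/
theorem IsStableFunctional.comp_partial_symmetrization {ℓ : (Config S → ℝ) →L[ℝ] ℝ}
    (h : IsStableFunctional ℓ) (x y : S) {α : ℝ} (h0 : 0 ≤ α) (h1 : α ≤ 1) :
    IsStableFunctional (ℓ ∘L (1 + α • (interchangeCLM x y - 1))) := by
  rcases eq_or_ne x y with rfl | hxy
  · simpa [interchangeCLM_self, ContinuousLinearMap.one_def] using h
  intro z hz
  have e : ℓ ∘L (1 + α • (interchangeCLM x y - 1))
      = (1 - α) • ℓ + α • (ℓ ∘L interchangeCLM x y) := by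
    ext f
    simp
    ring
  rw [e, functionalPGF_add, functionalPGF_smul, functionalPGF_smul, functionalPGF_comp_interchange]
  -- One of the coordinates x, y is held at `z x` and the other is the variable u. The two resulting
  -- affine functions agree at u = `z x`, and at u = `z y` they give the values at z and at z with
  -- x, y swapped.
  obtain ⟨a, b, hab⟩ := exists_functionalPGF_update_eq ℓ z y
  obtain ⟨a', b', hab'⟩ := exists_functionalPGF_update_eq ℓ (Function.update z y (z x)) x
  have hz1 : z = Function.update z y (z y) := by simp
  have hz2 : z ∘ Equiv.swap x y = Function.update (Function.update z y (z x)) x (z y) := by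
    funext w
    rcases eq_or_ne w x with rfl | hx
    · simp
    rcases eq_or_ne w y with rfl | hy
    · simp [hx]
    · simp [hx, hy, Equiv.swap_apply_of_ne_of_ne hx hy]
  have heq : a + b * z x = a' + b' * z x := by
    rw [← hab, ← hab']
    congr 1
    rw [eq_comm, Function.update_eq_self_iff, Function.update_of_ne hxy]
  rw [hz2, hab']
  conv in functionalPGF ℓ z => rw [hz1]
  rw [hab]
  push_cast
  exact convex_comb_affine_ne_zero (hz x)
    (fun u hu => hab u ▸ h _ (update_im_pos hz y hu))
    (fun u hu => hab' u ▸ h _ (update_im_pos (update_im_pos hz y (hz x)) x hu)) heq h0 h1 (hz y)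

/-- Harnack-type comparison of the values of a stable generating polynomial. -/
theorem IsStableFunctional.norm_functionalPGF_le {ℓ : (Config S → ℝ) →L[ℝ] ℝ}
    (h : IsStableFunctional ℓ) {z w : S → ℂ} (hz : ∀ x, 0 < (z x).im) (hw : ∀ x, 0 < (w x).im) :
    ‖functionalPGF ℓ w‖ ≤ (∏ x, (1 + ‖w x - z x‖ / (z x).im)) * ‖functionalPGF ℓ z‖ := by
  have key : ∀ s : Finset S, ‖functionalPGF ℓ (s.piecewise w z)‖
      ≤ (∏ x ∈ s, (1 + ‖w x - z x‖ / (z x).im)) * ‖functionalPGF ℓ z‖ := by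
    intro s
    induction s using Finset.induction_on with
    | empty => simp
    | insert x s hx ih =>
      have hv : ∀ y, 0 < (s.piecewise w z y).im := by
        intro y
        by_cases hy : y ∈ s
        · simpa [hy] using hw y
        · simpa [hy] using hz y
      obtain ⟨a, b, hab⟩ := exists_functionalPGF_update_eq ℓ (s.piecewise w z) x
      have h2 : functionalPGF ℓ (s.piecewise w z) = a + b * z x := by
        rw [← hab]
        congr 1
        rw [eq_comm, Function.update_eq_self_iff, Finset.piecewise_eq_of_notMem _ _ _ hx]
      rw [Finset.piecewise_insert, hab, Finset.prod_insert hx, mul_assoc]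
      refine (norm_affine_le (hz x)
        (fun u hu => hab u ▸ h _ (update_im_pos hv x hu))).trans ?_
      rw [← h2]
      have : 0 ≤ 1 + ‖w x - z x‖ / (z x).im := by
        have := hz x
        positivity
      gcongr
  simpa using key Finset.univ

open Filter Topology in
/-- A limit of stable functionals whose generating polynomial does not vanish at `(1, …, 1)` is
stable. -/
theorem isStableFunctional_of_tendsto {ℓ : (Config S → ℝ) →L[ℝ] ℝ}
    {A : ℕ → (Config S → ℝ) →L[ℝ] (Config S → ℝ)} {B : (Config S → ℝ) →L[ℝ] (Config S → ℝ)}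
    (hA : ∀ᶠ n in atTop, IsStableFunctional (ℓ ∘L A n)) (hlim : Tendsto A atTop (𝓝 B))
    (h1 : functionalPGF (ℓ ∘L B) 1 ≠ 0) : IsStableFunctional (ℓ ∘L B) := by
  intro z hz h0
  have hT : ∀ w, Tendsto (fun n => functionalPGF (ℓ ∘L A n) w) atTop
      (𝓝 (functionalPGF (ℓ ∘L B) w)) := fun w =>
    ((continuous_functionalPGF_comp ℓ w).tendsto B).comp hlim
  have hzero : ∀ w : S → ℂ, (∀ x, 0 < (w x).im) → functionalPGF (ℓ ∘L B) w = 0 := by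
    intro w hw
    have := le_of_tendsto_of_tendsto (hT w).norm
      ((hT z).norm.const_mul (∏ x, (1 + ‖w x - z x‖ / (z x).im)))
      (hA.mono fun n hn => hn.norm_functionalPGF_le hz hw)
    simpa [h0] using this
  refine h1 ?_
  -- The point (1, …, 1) lies on the boundary, so it is approached from inside the half-planes.
  have hc : Continuous fun ε : ℝ => functionalPGF (ℓ ∘L B) fun _ => 1 + ε * Complex.I :=
    (continuous_functionalPGF _).comp (by fun_prop)
  have hl := (hc.tendsto 0).mono_left (nhdsWithin_le_nhds (s := Set.Ioi 0))
  have h2 := tendsto_nhds_unique hl (tendsto_const_nhds.congr' <| by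
    filter_upwards [self_mem_nhdsWithin] with ε hε
    exact (hzero _ fun _ => by simpa using hε).symm)
  rw [← show (fun _ : S => (1 : ℂ)) = 1 from rfl]
  simpa using h2

/-! ### The generator and its semigroup -/

theorem exclusionGenerator_apply (p : Matrix S S ℝ) (f : Config S → ℝ) (η : Config S) :
    exclusionGenerator p f η = ∑ x : S, ∑ y : S,
      if η x = true ∧ η y = false then p x y * (f (interchange x y η) - f η) else 0 := rfl

/-- Averaging the sum with its relabelling x ↔ y removes the direction of the jump and yields the
1/2; pairs with equal occupation contribute nothing, as the interchange fixes η. -/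
theorem exclusionGenerator_eq {p : Matrix S S ℝ} (hp : p.IsSymm) :
    exclusionGenerator p
      = ((Finset.univ : Finset (S × S)).toList.map
          fun i => (p i.1 i.2 / 2) • (interchangeCLM i.1 i.2 - 1)).sum := by
  rw [Finset.sum_map_toList, Fintype.sum_prod_type]
  ext f η
  rw [exclusionGenerator_apply]
  simp only [_root_.sum_apply, Finset.sum_apply, _root_.smul_apply,
    _root_.sub_apply, Pi.smul_apply, Pi.sub_apply, smul_eq_mul,
    interchangeCLM_apply, one_apply_eq_self]
  set L := ∑ x : S, ∑ y : S,
    if η x = true ∧ η y = false then p x y * (f (interchange x y η) - f η) else 0 with hL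
  have hL' : L = ∑ x : S, ∑ y : S,
      if η y = true ∧ η x = false then p x y * (f (interchange x y η) - f η) else 0 := by
    rw [hL, Finset.sum_comm]
    refine Finset.sum_congr rfl fun x _ => Finset.sum_congr rfl fun y _ => ?_
    rw [interchange_comm y x, hp.apply]
  have h2 : L = (L + L) / 2 := by ring
  rw [h2]
  nth_rw 2 [hL']
  rw [hL, ← Finset.sum_add_distrib, Finset.sum_div]
  refine Finset.sum_congr rfl fun x _ => ?_
  rw [← Finset.sum_add_distrib, Finset.sum_div]
  refine Finset.sum_congr rfl fun y _ => ?_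
  rcases hx : η x <;> rcases hy : η y
  · simp [interchange_eq_self (hx.trans hy.symm)]
  · simp; ring
  · simp; ring
  · simp [interchange_eq_self (hx.trans hy.symm)]

theorem IsStableFunctional.comp_list_prod {ι : Type*}
    {R : ι → (Config S → ℝ) →L[ℝ] (Config S → ℝ)}
    {ℓ : (Config S → ℝ) →L[ℝ] ℝ} (h : IsStableFunctional ℓ) (l : List ι)
    (hR : ∀ i ∈ l, ∀ ℓ : (Config S → ℝ) →L[ℝ] ℝ, IsStableFunctional ℓ →
      IsStableFunctional (ℓ ∘L R i)) :
    IsStableFunctional (ℓ ∘L (l.map R).prod) := by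
  induction l generalizing ℓ with
  | nil => simpa [ContinuousLinearMap.one_def] using h
  | cons i l ih =>
    rw [List.map_cons, List.prod_cons, ContinuousLinearMap.mul_def,
      ← ContinuousLinearMap.comp_assoc]
    exact ih (hR i List.mem_cons_self ℓ h) fun j hj => hR j (List.mem_cons_of_mem _ hj)

theorem IsStableFunctional.comp_pow {R : (Config S → ℝ) →L[ℝ] (Config S → ℝ)}
    {ℓ : (Config S → ℝ) →L[ℝ] ℝ} (h : IsStableFunctional ℓ)
    (hR : ∀ ℓ : (Config S → ℝ) →L[ℝ] ℝ, IsStableFunctional ℓ → IsStableFunctional (ℓ ∘L R))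
    (n : ℕ) : IsStableFunctional (ℓ ∘L R ^ n) := by
  simpa using h.comp_list_prod (R := fun _ : Unit => R) (List.replicate n ()) fun _ _ => hR

open Filter Topology in
theorem IsStableFunctional.comp_exclusionSemigroup {p : Matrix S S ℝ} (hp : p.IsSymm)
    (hp0 : ∀ x y, 0 ≤ p x y) {ℓ : (Config S → ℝ) →L[ℝ] ℝ} (h : IsStableFunctional ℓ) (t : ℝ≥0)
    (h1 : functionalPGF (ℓ ∘L exclusionSemigroup p t) 1 ≠ 0) :
    IsStableFunctional (ℓ ∘L exclusionSemigroup p t) := by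
  set l : List (S × S) := Finset.univ.toList
  have hder := hasDerivAt_list_prod_one_add_smul
    (fun i : S × S => (p i.1 i.2 / 2) • (interchangeCLM i.1 i.2 - 1)) l
  rw [← exclusionGenerator_eq hp] at hder
  refine isStableFunctional_of_tendsto ?_
    (tendsto_pow_exp_of_hasDerivAt (by simp) hder t) h1
  -- With finitely many pairs, all factors are eventually genuine convex combinations.
  have hsmall : ∀ᶠ n : ℕ in atTop, ∀ i : S × S, (t : ℝ) / n * (p i.1 i.2 / 2) ≤ 1 := by
    rw [eventually_all]
    intro i
    have := (tendsto_const_div_atTop_nhds_zero_nat (t : ℝ)).mul_const (p i.1 i.2 / 2)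
    rw [zero_mul] at this
    exact this.eventually_le_const one_pos
  filter_upwards [hsmall] with n hn
  refine h.comp_pow (fun ℓ' h' => h'.comp_list_prod l fun i _ ℓ'' h'' => ?_) n
  rw [smul_smul]
  refine h''.comp_partial_symmetrization i.1 i.2 ?_ (hn i)
  have := hp0 i.1 i.2
  positivity

/-! ### Laws of the process as functionals -/

/-- Integration of observables against a measure on configurations. -/
noncomputable def expectationCLM (μ : Measure (Config S)) : (Config S → ℝ) →L[ℝ] ℝ :=
  ∑ η : Config S, μ.real {η} • ContinuousLinearMap.proj η

theorem expectationCLM_apply (μ : Measure (Config S)) [IsFiniteMeasure μ] (f : Config S → ℝ) :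
    expectationCLM μ f = ∫ η, f η ∂μ := by
  rw [integral_fintype Integrable.of_finite]
  simp [expectationCLM]

theorem functionalPGF_expectationCLM (μ : Measure (Config S)) (z : S → ℂ) :
    functionalPGF (expectationCLM μ) z = MvPolynomial.eval z (generatingPolynomial μ) := by
  unfold functionalPGF generatingPolynomial
  rw [map_sum]
  refine Finset.sum_congr rfl fun η _ => ?_
  rw [map_mul, map_prod, MvPolynomial.eval_C]
  congr 1
  · simp [expectationCLM, Pi.single_apply]
  · refine Finset.prod_congr rfl fun x _ => ?_
    split_ifs <;> simp

theorem functionalPGF_expectationCLM_one (μ : Measure (Config S)) [IsProbabilityMeasure μ] :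
    functionalPGF (expectationCLM μ) 1 = 1 := by
  have h : ∑ η : Config S, μ.real {η} = 1 := by simp
  simp only [functionalPGF, expectationCLM, Pi.one_apply, ite_self, Finset.prod_const_one, mul_one]
  simp [Pi.single_apply]
  exact_mod_cast h

theorem isStableFunctional_expectationCLM_iff (μ : Measure (Config S)) :
    IsStableFunctional (expectationCLM μ) ↔ IsStablePolynomial (generatingPolynomial μ) := by
  simp [IsStableFunctional, IsStablePolynomial, functionalPGF_expectationCLM]

/-- The law of an exclusion process at time `t` is the initial law transported by the
semigroup. -/
theorem IsExclusionProcess.expectationCLM_map {p : Matrix S S ℝ} {Ω : Type*} [MeasurableSpace Ω]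
    {P : Measure Ω} [IsProbabilityMeasure P] {η : ℝ≥0 → Ω → Config S}
    (hη : IsExclusionProcess p P η) (t : ℝ≥0) :
    expectationCLM (P.map (η t)) = expectationCLM (P.map (η 0)) ∘L exclusionSemigroup p t := by
  have hprob : ∀ s, IsProbabilityMeasure (P.map (η s)) := fun s =>
    Measure.isProbabilityMeasure_map (hη.measurable s).aemeasurable
  ext1 f
  have hint : ∀ (s : ℝ≥0) (g : Config S → ℝ),
      expectationCLM (P.map (η s)) g = ∫ ω, g (η s ω) ∂P := fun s g => by
    rw [expectationCLM_apply, integral_map (hη.measurable s).aemeasurable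
      (Measurable.of_discrete).aestronglyMeasurable]
  have hm : (⨆ u ∈ Set.Iic (0 : ℝ≥0), MeasurableSpace.comap (η u) inferInstance)
      ≤ (inferInstance : MeasurableSpace Ω) :=
    iSup₂_le fun u _ => (hη.measurable u).comap_le
  -- Only the Markov property from time 0 is needed, integrated over Ω.
  rw [ContinuousLinearMap.comp_apply, hint, hint, ← integral_congr_ae (hη.markov 0 t f),
    integral_condExp hm, zero_add]

end

theorem corollary5p3 {S : Type*} [Fintype S] [DecidableEq S] (p : Matrix S S ℝ)
    (hp : IsSymmetricIrreducibleChain p)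
    {Ω : Type*} [MeasurableSpace Ω] (P : Measure Ω) [IsProbabilityMeasure P]
    (η : ℝ≥0 → Ω → Config S) (hη : IsExclusionProcess p P η)
    (h0 : IsStablePolynomial (generatingPolynomial (P.map (η 0))))
    (t : ℝ≥0) (ht : 0 < t) :
    IsStablePolynomial (generatingPolynomial (P.map (η t))) := by
  have hprob : ∀ s, IsProbabilityMeasure (P.map (η s)) := fun s =>
    Measure.isProbabilityMeasure_map (hη.measurable s).aemeasurable
  rw [← isStableFunctional_expectationCLM_iff] at h0 ⊢
  have h1 := functionalPGF_expectationCLM_one (P.map (η t))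
  rw [hη.expectationCLM_map t] at h1 ⊢
  exact h0.comp_exclusionSemigroup hp.symmetric
    (fun x y => Matrix.nonneg_of_mem_rowStochastic hp.stochastic) t (by rw [h1]; exact one_ne_zero)
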